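/- Let $M$ be a smooth manifold (Hausdorff, second countable, without boundary, of dimension $n$), and let $\mathcal F$ and $\mathcal G$ be two smooth foliations of $M$ that are complementary, i.e. $T_xM = T_x\mathcal F\oplus T_x\mathcal G$ for every $x\in M$. Suppose that both foliations admit closed defining forms: there are closed smooth differential forms $\alpha$ and $\beta$ on $M$, of degrees equal to the codimensions of $\mathcal F$ and of $\mathcal G$ respectively, such that for every $x\in M$ $$T_x\mathcal F=\{v\in T_xM : \iota_v\alpha_x=0\},\qquad T_x\mathcal G=\{v\in T_xM : \iota_v\beta_x=0\}.$$ Then there is a smooth Riemannian metric $g$ on $M$ for which $\mathcal F$ and $\mathcal G$ are orthogonal, i.e. $g(v,w)=0$ for all $x\in M$, $v\in T_x\mathcal F$ and $w\in T_x\mathcal G$, and for which all leaves of $\mathcal F$ and all leaves of $\mathcal G$ are minimal submanifolds, i.e. have identically vanishing mean curvature vector. -/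

import Mathlib

open scoped Manifold ContDiff Topology

noncomputable section

/-! ## Vector fields, Riemannian metrics and the Levi-Civita connection

All manifolds are modelled on `EuclideanSpace ℝ (Fin n)`. -/

section Riemannian

variable {n : ℕ} {M : Type*} [TopologicalSpace M] [ChartedSpace (EuclideanSpace ℝ (Fin n)) M]
  [IsManifold (𝓡 n) ∞ M]

/-- The vector field `X` is differentiable at the point `x`. -/
def DiffFieldAt (X : ∀ y : M, TangentSpace (𝓡 n) y) (x : M) : Prop :=
  MDifferentiableAt (𝓡 n) ((𝓡 n).prod 𝓘(ℝ, EuclideanSpace ℝ (Fin n)))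
    (fun y => (⟨y, X y⟩ : TangentBundle (𝓡 n) M)) x

/-- The vector field `X` is smooth at the point `x`. -/
def SmoothFieldAt (X : ∀ y : M, TangentSpace (𝓡 n) y) (x : M) : Prop :=
  ContMDiffAt (𝓡 n) ((𝓡 n).prod 𝓘(ℝ, EuclideanSpace ℝ (Fin n))) ∞
    (fun y => (⟨y, X y⟩ : TangentBundle (𝓡 n) M)) x

variable (n M) in
/-- A smooth Riemannian metric on `M`. -/
abbrev RiemannianMetricOn : Type _ :=
  Bundle.ContMDiffRiemannianMetric (𝓡 n) ∞ (EuclideanSpace ℝ (Fin n))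
    (fun x : M => TangentSpace (𝓡 n) x)

/-- The standard basis of `T_x M`, in the coordinates of the preferred chart at `x`. -/
def tangentBasis (x : M) : Module.Basis (Fin n) ℝ (TangentSpace (𝓡 n) x) :=
  (EuclideanSpace.basisFun (Fin n) ℝ).toBasis

/-- The `i`-th coordinate vector field of the preferred chart at `x`. -/
def coordField (x : M) (i : Fin n) : ∀ y : M, TangentSpace (𝓡 n) y :=
  FiberBundle.extend (E := fun y : M => TangentSpace (𝓡 n) y) (EuclideanSpace ℝ (Fin n))
    (tangentBasis x i)

namespace RiemannianMetricOn

variable (g : RiemannianMetricOn n M)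

/-- The inner product on `T_x M` as a bilinear form. -/
def bilin (x : M) : LinearMap.BilinForm ℝ (TangentSpace (𝓡 n) x) :=
  LinearMap.mk₂ ℝ (fun v w => g.inner x v w) (by simp) (by simp) (by simp) (by simp)

theorem bilin_nondegenerate (x : M) : (g.bilin x).Nondegenerate := by
  refine ⟨fun v hv => ?_, fun v hv => ?_⟩ <;>
  · by_contra h
    exact (g.pos x v h).ne' (hv v)

/-- The vector of `T_x M` that represents a linear form on `T_x M` through the metric. -/
def sharp (x : M) (φ : Module.Dual ℝ (TangentSpace (𝓡 n) x)) : TangentSpace (𝓡 n) x :=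
  haveI : FiniteDimensional ℝ (TangentSpace (𝓡 n) x) :=
    inferInstanceAs (FiniteDimensional ℝ (EuclideanSpace ℝ (Fin n)))
  ((g.bilin x).toDual (g.bilin_nondegenerate x)).symm φ

/-- The right-hand side of the Koszul formula for `g(∇_X Y, Z)` at the point `x`. -/
def koszul (X Y Z : ∀ y : M, TangentSpace (𝓡 n) y) (x : M) : ℝ :=
  (1 / 2) *
    (mvfderiv (𝓡 n) (fun y => g.inner y (Y y) (Z y)) x (X x)
      + mvfderiv (𝓡 n) (fun y => g.inner y (X y) (Z y)) x (Y x)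
      - mvfderiv (𝓡 n) (fun y => g.inner y (X y) (Y y)) x (Z x)
      + g.inner x (VectorField.mlieBracket (𝓡 n) X Y x) (Z x)
      - g.inner x (VectorField.mlieBracket (𝓡 n) X Z x) (Y x)
      - g.inner x (VectorField.mlieBracket (𝓡 n) Y Z x) (X x))

/-- The Levi-Civita derivative `∇_X Y` at the point `x`: the vector whose inner products with the
coordinate fields at `x` are given by the Koszul formula. The lemmas below check that the formula
then holds for all test fields, and that the connection is torsion-free and metric. -/
def leviCivita (X Y : ∀ y : M, TangentSpace (𝓡 n) y) (x : M) : TangentSpace (𝓡 n) x :=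
  g.sharp x ((tangentBasis x).constr ℝ (fun i => g.koszul X Y (coordField x i) x))

theorem inner_sharp (x : M) (φ : Module.Dual ℝ (TangentSpace (𝓡 n) x))
    (v : TangentSpace (𝓡 n) x) : g.inner x (g.sharp x φ) v = φ v := by
  have : FiniteDimensional ℝ (TangentSpace (𝓡 n) x) :=
    inferInstanceAs (FiniteDimensional ℝ (EuclideanSpace ℝ (Fin n)))
  exact LinearMap.BilinForm.apply_toDual_symm_apply (hB := g.bilin_nondegenerate x) φ v

open scoped Bundle in
theorem mdifferentiableAt_inner {X Y : ∀ y : M, TangentSpace (𝓡 n) y} {x : M}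
    (hX : DiffFieldAt X x) (hY : DiffFieldAt Y x) :
    MDifferentiableAt (𝓡 n) 𝓘(ℝ, ℝ) (fun y => g.inner y (X y) (Y y)) x := by
  let : Bundle.RiemannianBundle (fun x : M => TangentSpace (𝓡 n) x) := ⟨g.toRiemannianMetric⟩
  exact MDifferentiableAt.inner_bundle (F := EuclideanSpace ℝ (Fin n))
    (E := fun x : M => TangentSpace (𝓡 n) x) (b := fun y : M => y) hX hY

theorem tensorialAt_koszul {X Y : ∀ y : M, TangentSpace (𝓡 n) y} {x : M}
    (hX : DiffFieldAt X x) (hY : DiffFieldAt Y x) :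
    TensorialAt (𝓡 n) (EuclideanSpace ℝ (Fin n)) (fun Z => g.koszul X Y Z x) x := by
  constructor
  · intro f Z hf hZ
    simp only [koszul, Pi.smul_apply', map_smul, smul_eq_mul]
    rw [mvfderiv_fun_mul hf (g.mdifferentiableAt_inner hY hZ),
      mvfderiv_fun_mul hf (g.mdifferentiableAt_inner hX hZ),
      VectorField.mlieBracket_smul_right hf hZ, VectorField.mlieBracket_smul_right hf hZ]
    simp [g.symm x (Z x)]
    ring
  · intro Z Z' hZ hZ'
    simp only [koszul, Pi.add_apply, map_add]
    rw [mvfderiv_fun_add (g.mdifferentiableAt_inner hY hZ) (g.mdifferentiableAt_inner hY hZ'),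
      mvfderiv_fun_add (g.mdifferentiableAt_inner hX hZ) (g.mdifferentiableAt_inner hX hZ'),
      VectorField.mlieBracket_add_right hZ hZ', VectorField.mlieBracket_add_right hZ hZ']
    simp
    ring

/-- The Koszul formula, for all test fields. -/
theorem inner_leviCivita {X Y Z : ∀ y : M, TangentSpace (𝓡 n) y} {x : M}
    (hX : DiffFieldAt X x) (hY : DiffFieldAt Y x) (hZ : DiffFieldAt Z x) :
    g.inner x (g.leviCivita X Y x) (Z x) = g.koszul X Y Z x := by
  have hT := g.tensorialAt_koszul hX hY
  rw [← TensorialAt.mkHom_apply hT hZ, leviCivita, inner_sharp]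
  have h : (tangentBasis x).constr ℝ (fun i => g.koszul X Y (coordField x i) x)
      = (TensorialAt.mkHom _ x hT).toLinearMap := by
    refine (tangentBasis x).ext fun i => ?_
    rw [Module.Basis.constr_basis]
    rfl
  rw [h]
  rfl

/-- The Levi-Civita connection is torsion-free. -/
theorem leviCivita_sub_leviCivita {X Y : ∀ y : M, TangentSpace (𝓡 n) y} {x : M}
    (hX : DiffFieldAt X x) (hY : DiffFieldAt Y x) :
    g.leviCivita X Y x - g.leviCivita Y X x = VectorField.mlieBracket (𝓡 n) X Y x := by
  have key : ∀ z : TangentSpace (𝓡 n) x,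
      g.inner x (g.leviCivita X Y x - g.leviCivita Y X x) z
        = g.inner x (VectorField.mlieBracket (𝓡 n) X Y x) z := by
    intro z
    have hz : DiffFieldAt (FiberBundle.extend (E := fun y : M => TangentSpace (𝓡 n) y)
        (EuclideanSpace ℝ (Fin n)) z) x := FiberBundle.mdifferentiableAt_extend ..
    have e : FiberBundle.extend (E := fun y : M => TangentSpace (𝓡 n) y)
        (EuclideanSpace ℝ (Fin n)) z x = z := by simp
    have h1 := g.inner_leviCivita hX hY hz
    have h2 := g.inner_leviCivita hY hX hz
    rw [e] at h1 h2
    rw [map_sub, sub_apply, h1, h2]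
    simp only [koszul, e, VectorField.mlieBracket_swap (V := Y) (W := X), Pi.neg_apply, map_neg,
      neg_apply, fun y => g.symm y (Y y) (X y)]
    ring
  by_contra hne
  have h := g.pos x _ (sub_ne_zero.2 hne)
  rw [map_sub (g.inner x), sub_apply, key, sub_self] at h
  exact lt_irrefl _ h

/-- The Levi-Civita connection is compatible with the metric. -/
theorem mvfderiv_inner {X Y Z : ∀ y : M, TangentSpace (𝓡 n) y} {x : M}
    (hX : DiffFieldAt X x) (hY : DiffFieldAt Y x) (hZ : DiffFieldAt Z x) :
    mvfderiv (𝓡 n) (fun y => g.inner y (Y y) (Z y)) x (X x)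
      = g.inner x (g.leviCivita X Y x) (Z x) + g.inner x (Y x) (g.leviCivita X Z x) := by
  rw [g.symm x (Y x), g.inner_leviCivita hX hY hZ, g.inner_leviCivita hX hZ hY]
  simp only [koszul, VectorField.mlieBracket_swap (V := Z) (W := Y), Pi.neg_apply, map_neg,
    neg_apply, fun y => g.symm y (Z y) (Y y)]
  ring

end RiemannianMetricOn

end Riemannian

/-! ## Differential forms on a manifold -/

section Forms

variable {n : ℕ} {M : Type*} [TopologicalSpace M] [ChartedSpace (EuclideanSpace ℝ (Fin n)) M]

variable (n M) in
/-- A (not necessarily continuous) differential form of degree `k` on `M`. -/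
abbrev DiffForm (k : ℕ) : Type _ :=
  ∀ x : M, TangentSpace (𝓡 n) x [⋀^Fin k]→L[ℝ] ℝ

namespace DiffForm

variable {k : ℕ}

/-- The expression of a form in a chart `e`: its pullback under `e.symm`. -/
def inChart (α : DiffForm n M k) (e : OpenPartialHomeomorph M (EuclideanSpace ℝ (Fin n)))
    (u : EuclideanSpace ℝ (Fin n)) : EuclideanSpace ℝ (Fin n) [⋀^Fin k]→L[ℝ] ℝ :=
  (α (e.symm u)).compContinuousLinearMap
    (mfderiv 𝓘(ℝ, EuclideanSpace ℝ (Fin n)) (𝓡 n) e.symm u)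

/-- The form is smooth: it is smooth in every smooth chart. -/
def IsSmooth (α : DiffForm n M k) : Prop :=
  ∀ e ∈ IsManifold.maximalAtlas (𝓡 n) ∞ M, ContDiffOn ℝ ∞ (α.inChart e) e.target

/-- The form is closed: its exterior derivative vanishes in every smooth chart. -/
def IsClosed (α : DiffForm n M k) : Prop :=
  ∀ e ∈ IsManifold.maximalAtlas (𝓡 n) ∞ M, ∀ u ∈ e.target, extDeriv (α.inChart e) u = 0

/-- The kernel of the form at `x`: the vectors whose interior product with the form is zero. -/
def kernel (α : DiffForm n M k) (x : M) : Set (TangentSpace (𝓡 n) x) :=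
  {v | ∀ m : Fin k → TangentSpace (𝓡 n) x, (∃ i, m i = v) → α x m = 0}

end DiffForm

end Forms

/-! ## Foliations -/

section Foliations

/-- The subspace `ℝ^p × 0` of `ℝ^n`. -/
def horizontalSubspace (n p : ℕ) : Submodule ℝ (EuclideanSpace ℝ (Fin n)) where
  carrier := {v | ∀ i : Fin n, p ≤ (i : ℕ) → v i = 0}
  add_mem' := fun {v w} hv hw i hi => by simp [hv i hi, hw i hi]
  zero_mem' := fun i _ => by simp
  smul_mem' := fun c v hv i hi => by simp [hv i hi]

variable {n : ℕ} (M : Type*) [TopologicalSpace M] [ChartedSpace (EuclideanSpace ℝ (Fin n)) M]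

/-- A smooth foliation of `M` with leaves of dimension `p`, given by an atlas of foliated charts:
smooth charts that cover `M` and whose transition maps preserve the directions of the slices
`ℝ^p × {c}`, so that locally they have the form `(a, b) ↦ (f (a, b), h b)`. -/
structure SmoothFoliation (n : ℕ) (M : Type*) [TopologicalSpace M]
    [ChartedSpace (EuclideanSpace ℝ (Fin n)) M] (p : ℕ) where
  dim_le : p ≤ n
  charts : Set (OpenPartialHomeomorph M (EuclideanSpace ℝ (Fin n)))
  charts_subset : charts ⊆ IsManifold.maximalAtlas (𝓡 n) ∞ M
  cover : ∀ x : M, ∃ e ∈ charts, x ∈ e.source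
  compatible : ∀ e ∈ charts, ∀ e' ∈ charts, ∀ u ∈ (e.symm.trans e').source,
    ∀ v ∈ horizontalSubspace n p, fderiv ℝ (e.symm.trans e') u v ∈ horizontalSubspace n p

namespace SmoothFoliation

variable {M} {p q : ℕ}

/-- The tangent space at `x` of the leaf through `x`: the vectors that are horizontal in the
foliated charts at `x`. -/
def tangentSpace (F : SmoothFoliation n M p) (x : M) : Submodule ℝ (TangentSpace (𝓡 n) x) where
  carrier := {v | ∀ e ∈ F.charts, x ∈ e.source →
    (mfderiv (𝓡 n) 𝓘(ℝ, EuclideanSpace ℝ (Fin n)) e x v : EuclideanSpace ℝ (Fin n))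
      ∈ horizontalSubspace n p}
  add_mem' := fun {v w} hv hw e he hx => by
    rw [map_add]
    exact (horizontalSubspace n p).add_mem (hv e he hx) (hw e he hx)
  zero_mem' := fun e he hx => by
    rw [map_zero]
    exact (horizontalSubspace n p).zero_mem
  smul_mem' := fun c v hv e he hx => by
    rw [map_smul]
    exact (horizontalSubspace n p).smul_mem c (hv e he hx)

/-- `y` lies on the plaque through `x` in some foliated chart, plaques being the connected
components of the slices. -/
def SamePlaque (F : SmoothFoliation n M p) (x y : M) : Prop :=
  ∃ e ∈ F.charts, x ∈ e.source ∧ y ∈ e.source ∧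
    e y ∈ connectedComponentIn {u | u ∈ e.target ∧ u - e x ∈ horizontalSubspace n p} (e x)

/-- The leaf through `x`: the points that are joined to `x` by a chain of plaques. -/
def leaf (F : SmoothFoliation n M p) (x : M) : Set M :=
  {y | Relation.EqvGen F.SamePlaque x y}

/-- Two foliations are complementary: `T_x M = T_x F ⊕ T_x G` for all `x`. -/
def Complementary (F : SmoothFoliation n M p) (G : SmoothFoliation n M q) : Prop :=
  ∀ x : M, IsCompl (F.tangentSpace x) (G.tangentSpace x)

/-- The foliation has a closed defining form: a smooth closed form of degree the codimension of
the foliation whose kernel is the tangent distribution of the foliation. -/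
def HasClosedDefiningForm (F : SmoothFoliation n M p) : Prop :=
  ∃ α : DiffForm n M (n - p), α.IsSmooth ∧ α.IsClosed ∧
    ∀ x : M, α.kernel x = (F.tangentSpace x : Set (TangentSpace (𝓡 n) x))

variable [IsManifold (𝓡 n) ∞ M]

/-- The two foliations are orthogonal for the metric `g`. -/
def Orthogonal (F : SmoothFoliation n M p) (G : SmoothFoliation n M q)
    (g : RiemannianMetricOn n M) : Prop :=
  ∀ x : M, ∀ v ∈ F.tangentSpace x, ∀ w ∈ G.tangentSpace x, g.inner x v w = 0

/-- `X 0, …, X (p - 1)` are vector fields that are smooth at `x`, tangent to the foliation near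
`x`, and orthonormal at `x`. -/
structure IsTangentFrameAt (F : SmoothFoliation n M p) (g : RiemannianMetricOn n M) (x : M)
    (X : Fin p → ∀ y : M, TangentSpace (𝓡 n) y) : Prop where
  smooth : ∀ i, SmoothFieldAt (X i) x
  tangent : ∀ i, ∀ᶠ y in 𝓝 x, X i y ∈ F.tangentSpace y
  orthonormal : ∀ i j, g.inner x (X i x) (X j x) = if i = j then 1 else 0

/-- `H` is the mean curvature vector at `x` of the leaf through `x`, that is the trace of the
second fundamental form `(X, Y) ↦ (∇_X Y)^⊥` of the leaf (not divided by `p`): it is normal to the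
leaf, and it is the normal component of `∑ i, ∇_{X i} (X i)` for the frames `X` as above. -/
def IsMeanCurvatureVectorAt (F : SmoothFoliation n M p) (g : RiemannianMetricOn n M) (x : M)
    (H : TangentSpace (𝓡 n) x) : Prop :=
  (∀ v ∈ F.tangentSpace x, g.inner x H v = 0) ∧
    ∀ X : Fin p → ∀ y : M, TangentSpace (𝓡 n) y, F.IsTangentFrameAt g x X →
      (∑ i, g.leviCivita (X i) (X i) x) - H ∈ F.tangentSpace x

/-- All leaves are minimal: their mean curvature vectors vanish at all of their points. -/
def HasMinimalLeaves (F : SmoothFoliation n M p) (g : RiemannianMetricOn n M) : Prop :=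
  ∀ x₀ : M, ∀ x ∈ F.leaf x₀, F.IsMeanCurvatureVectorAt g x 0

end SmoothFoliation

end Foliations

end

/-! This is Rummler's criterion, applied twice. Let `B` be a smooth positive semidefinite form on
`TM` with kernel `TG`, and `C` one with kernel `TF`. Then `g = B + C` is a Riemannian metric, the
foliations are orthogonal, and on leaves of `F` the metric is just `B`. Since `β` also has kernel
`TG`, the function `β(X₁, …, X_p) ^ 2` is a positive multiple of the Gram determinant of `B`.
Rescaling `B` makes the multiple 1, so `β` restricts to the volume form of the leaves of `F`, up to
sign. In the same way `α` normalizes `C` for the leaves of `G`.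

In a chart foliated for `G`, let `W` be a constant field tangent to `G`. As `dβ = 0` and `ι_W β =
0`, the coefficients of `β` do not change along `W`: moving leaves of `F` along `G` preserves their
volume, so they have no mean curvature. Infinitesimally, for a frame `X` of `TF` that is orthonormal
at `x`, Koszul gives `g(∇_{X i} X i, W) = g([W, X i], X i) - 1/2 W(g(X i, X i))`. The two terms
cancel after summation over `i`: the Gram determinant of `X` is `β(X) ^ 2`, and its `W`-derivative
at `x` involves only the derivatives of the components of `X`, which are the brackets `[W, X i]`.

The main steps are `exists_isTransverseMetric` (partition of unity),
`exists_isTransverseMetric_isNormalizedBy` (rescaling), `DiffForm.fderiv_inChart_eq_zero`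
(invariance of `β`) and `inner_sum_leviCivita_eq_zero` (the cancellation). -/

noncomputable section

/-! ### Alternating forms, Gram determinants and the derivative of the determinant. -/

section LinearAlgebra

/-- An alternating map does not see changes of its arguments by vectors of its kernel. -/
theorem AlternatingMap.map_add_of_forall_mem_kernel {V ι : Type*} [AddCommGroup V] [Module ℝ V]
    [Fintype ι] [DecidableEq ι] (β : V [⋀^ι]→ₗ[ℝ] ℝ) (X Y : ι → V)
    (hY : ∀ m : ι → V, (∃ i j, m i = Y j) → β m = 0) : β (X + Y) = β X := by
  have h := β.toMultilinearMap.map_add_univ X Y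
  simp only [AlternatingMap.coe_multilinearMap] at h
  -- In the multilinear expansion, every term except the one with all arguments from `X` has some
  -- argument `Y i`.
  rw [h, Finset.sum_eq_single Finset.univ]
  · simp
  · intro s _ hs
    obtain ⟨i, hi⟩ : ∃ i, i ∉ s := by
      by_contra! hc
      exact hs (Finset.eq_univ_iff_forall.2 hc)
    exact hY _ ⟨i, i, by simp [hi]⟩
  · simp

/-- The square of an alternating form of degree `k` is proportional to the Gram determinant of a
bilinear form, if both forms vanish on a common subspace of codimension `k`. -/
theorem exists_sq_eq_mul_det {V : Type*} [AddCommGroup V] [Module ℝ V]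
    {k : ℕ} {N N' : Submodule ℝ V} (hN : IsCompl N' N)
    [FiniteDimensional ℝ N'] (hk : Module.finrank ℝ N' = k)
    (β : V [⋀^Fin k]→ₗ[ℝ] ℝ) (hβ : ∀ v ∈ N, ∀ m : Fin k → V, (∃ i, m i = v) → β m = 0)
    (B : V →ₗ[ℝ] V →ₗ[ℝ] ℝ) (hl : ∀ v ∈ N, ∀ w, B v w = 0) (hr : ∀ v ∈ N, ∀ w, B w v = 0)
    (hB : ∀ v ∈ N', v ≠ 0 → 0 < B v v) (hs : ∀ v w, B v w = B w v) :
    ∃ c : ℝ, 0 ≤ c ∧ ∀ X : Fin k → V, β X ^ 2 = c * (Matrix.of fun i j => B (X i) (X j)).det := by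
  let b : Module.Basis (Fin k) ℝ N' := Module.finBasisOfFinrankEq ℝ N' hk
  let G : Matrix (Fin k) (Fin k) ℝ := Matrix.of fun i j => B (b i) (b j)
  have hG : 0 < G.det := by
    refine Matrix.PosDef.det_pos (Matrix.PosDef.of_dotProduct_mulVec_pos ?_ ?_)
    · ext i j
      simp [G, hs (b i)]
    · intro x hx
      have h : star x ⬝ᵥ G.mulVec x = B ↑(∑ i, x i • b i) ↑(∑ i, x i • b i) := by
        simp [G, dotProduct, Matrix.mulVec, map_sum, Finset.mul_sum]
        refine Finset.sum_congr rfl fun i _ => Finset.sum_congr rfl fun j _ => by rw [hs (b j)]; ring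
      rw [h]
      refine hB _ (Subtype.prop _) fun h0 => hx ?_
      ext i
      exact Fintype.linearIndependent_iff.1 b.linearIndependent x (Subtype.ext h0) i
  -- The constant is forced by `X = b`. For general `X`, projecting to `N'` along `N` changes
  -- neither side, and a matrix `A` of coordinates multiplies both by `A.det ^ 2`.
  refine ⟨β (fun i => b i) ^ 2 / G.det, by positivity, fun X => ?_⟩
  let P : V →ₗ[ℝ] N' := N'.projectionOnto N hN
  have hP : ∀ v, v - P v ∈ N := fun v => by
    rw [← Submodule.ker_projectionOnto hN, LinearMap.mem_ker, map_sub,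
      Submodule.projectionOnto_apply_left, sub_self]
  have hX : β X = β (fun i => P (X i)) := by
    have := AlternatingMap.map_add_of_forall_mem_kernel β (fun i => (P (X i) : V))
      (fun i => X i - P (X i)) (fun m ⟨i, j, h⟩ => hβ _ (hP (X j)) m ⟨i, h⟩)
    rw [← this]
    congr 1
    ext i
    simp
  let A := b.toMatrix (fun i => P (X i))
  have hdet : β (fun i => P (X i)) = β (fun i => b i) * A.det := by
    have h := congrArg (fun f => f (fun i => P (X i)))
      ((β.compLinearMap N'.subtype).eq_smul_basis_det b)
    simpa [Module.Basis.det_apply, Function.comp_def] using h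
  have hgram : (Matrix.of fun i j => B (X i) (X j)) = A.transpose * G * A := by
    ext i j
    have h : ∀ v w, B v w = B (P v) (P w) := fun v w => by
      have h1 := hl _ (hP v) w
      have h2 := hr _ (hP w) (P v)
      rw [map_sub, LinearMap.sub_apply] at h1
      rw [map_sub] at h2
      linarith
    have hsum : ∀ i, (P (X i) : V) = ∑ a, A a i • (b a : V) := fun i => by
      have h := congrArg (N'.subtype) (b.sum_repr (P (X i))).symm
      rw [map_sum] at h
      exact h
    rw [Matrix.of_apply, h, hsum, hsum]
    simp only [map_sum, map_smul, LinearMap.sum_apply, LinearMap.smul_apply, smul_eq_mul,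
      Matrix.mul_apply, Matrix.transpose_apply, Finset.sum_mul, G, Matrix.of_apply, Finset.mul_sum]
    refine Finset.sum_congr rfl fun a _ => Finset.sum_congr rfl fun c _ => by ring
  rw [hX, hdet, hgram, Matrix.det_mul, Matrix.det_mul, Matrix.det_transpose]
  field_simp

/-- The derivative of the determinant at the identity matrix is the trace. -/
theorem hasFDerivAt_det_of_eq_one {W : Type*} [NormedAddCommGroup W] [NormedSpace ℝ W] {k : ℕ}
    {A : W → Matrix (Fin k) (Fin k) ℝ} {A' : Fin k → Fin k → W →L[ℝ] ℝ} {u : W}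
    (hA : ∀ i j, HasFDerivAt (fun y => A y i j) (A' i j) u) (h1 : A u = 1) :
    HasFDerivAt (fun y => (A y).det) (∑ i, A' i i) u := by
  simp only [Matrix.det_apply]
  have h : ∀ σ ∈ (Finset.univ : Finset (Equiv.Perm (Fin k))),
      HasFDerivAt (fun y => Equiv.Perm.sign σ • ∏ i, A y (σ i) i)
        (if σ = 1 then ∑ i, A' i i else 0) u := by
    intro σ _
    have hp := (HasFDerivAt.finsetProd (u := Finset.univ)
      (fun i (_ : i ∈ Finset.univ) => hA (σ i) i)).const_smul (Equiv.Perm.sign σ)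
    refine hp.congr_fderiv ?_
    split_ifs with hσ
    · subst hσ
      simp only [Equiv.Perm.sign_one, one_smul, Equiv.Perm.coe_one, id]
      refine Finset.sum_congr rfl fun i _ => ?_
      rw [Finset.prod_eq_one fun j _ => by rw [h1, Matrix.one_apply_eq], one_smul]
    · rw [Finset.sum_eq_zero, smul_zero]
      intro i _
      obtain ⟨j, hj⟩ : ∃ j, σ j ≠ j := by
        by_contra! hc
        exact hσ (Equiv.ext hc)
      -- A nontrivial permutation moves at least two indices. Differentiating the factor at `i`
      -- therefore leaves an off-diagonal entry of the identity matrix in the product.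
      have : ∃ l ∈ Finset.univ.erase i, σ l ≠ l := by
        by_cases hij : j = i
        · refine ⟨σ j, by simpa [← hij] using hj, fun h => hj (σ.injective h)⟩
        · exact ⟨j, by simp [hij], hj⟩
      obtain ⟨l, hl, hne⟩ := this
      rw [Finset.prod_eq_zero hl (by rw [h1, Matrix.one_apply_ne hne]), zero_smul]
  have := HasFDerivAt.fun_sum h
  simpa using this

end LinearAlgebra

/-! ### Foliated charts and the dimension of the leaves. -/

section Charts

variable {n : ℕ} {M : Type*} [TopologicalSpace M] [ChartedSpace (EuclideanSpace ℝ (Fin n)) M]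
  {e : OpenPartialHomeomorph M (EuclideanSpace ℝ (Fin n))}

/-- The smooth charts are differentiable, with differentiable inverses. -/
theorem mdifferentiable_of_mem_maximalAtlas (he : e ∈ IsManifold.maximalAtlas (𝓡 n) ∞ M) :
    e.MDifferentiable (𝓡 n) 𝓘(ℝ, EuclideanSpace ℝ (Fin n)) :=
  ⟨(contMDiffOn_of_mem_maximalAtlas he).mdifferentiableOn (by simp),
    (contMDiffOn_symm_of_mem_maximalAtlas he).mdifferentiableOn (by simp)⟩

/-- The derivative of a chart, as a linear map to `ℝ^n`. -/
abbrev chartDeriv (e : OpenPartialHomeomorph M (EuclideanSpace ℝ (Fin n))) (x : M) :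
    TangentSpace (𝓡 n) x →L[ℝ] EuclideanSpace ℝ (Fin n) :=
  mfderiv (𝓡 n) 𝓘(ℝ, EuclideanSpace ℝ (Fin n)) e x

/-- The derivative of a smooth chart, as an isomorphism of the tangent space with `ℝ^n`. -/
def tangentEquiv (he : e ∈ IsManifold.maximalAtlas (𝓡 n) ∞ M) {x : M} (hx : x ∈ e.source) :
    TangentSpace (𝓡 n) x ≃L[ℝ] EuclideanSpace ℝ (Fin n) :=
  (mdifferentiable_of_mem_maximalAtlas he).mfderiv hx

instance (x : M) : FiniteDimensional ℝ (TangentSpace (𝓡 n) x) :=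
  inferInstanceAs (FiniteDimensional ℝ (EuclideanSpace ℝ (Fin n)))

theorem finrank_horizontalSubspace {p : ℕ} (hp : p ≤ n) :
    Module.finrank ℝ (horizontalSubspace n p) = p := by
  let f : horizontalSubspace n p ≃ₗ[ℝ] (Fin p → ℝ) :=
    { toFun := fun v i => v.1 (Fin.castLE hp i)
      map_add' := fun v w => rfl
      map_smul' := fun c v => rfl
      invFun := fun w => ⟨WithLp.toLp 2 fun i => if h : (i : ℕ) < p then w ⟨i, h⟩ else 0,
        fun i hi => by simp [hi]⟩
      left_inv := fun v => by
        ext i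
        by_cases h : (i : ℕ) < p
        · simp [h]
        · simp [h, v.2 i (not_lt.1 h)]
      right_inv := fun w => by
        ext i
        simp }
  rw [f.finrank_eq, Module.finrank_fin_fun]

variable {p q : ℕ}

namespace SmoothFoliation

variable (F : SmoothFoliation n M p) (G : SmoothFoliation n M q)

/-- The leaf directions can be read off in a single foliated chart. -/
theorem mem_tangentSpace_iff (he : e ∈ F.charts) {x : M} (hx : x ∈ e.source)
    {v : TangentSpace (𝓡 n) x} :
    v ∈ F.tangentSpace x ↔ chartDeriv e x v ∈ horizontalSubspace n p := by
  refine ⟨fun h => h e he hx, fun h e' he' hx' => ?_⟩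
  have hd := mdifferentiable_of_mem_maximalAtlas (F.charts_subset he)
  have hd' := mdifferentiable_of_mem_maximalAtlas (F.charts_subset he')
  have hu : e x ∈ (e.symm.trans e').source := by simp [hx, hx']
  have h1 := F.compatible e he e' he' (e x) hu _ h
  have hm : MDifferentiableAt 𝓘(ℝ, EuclideanSpace ℝ (Fin n)) 𝓘(ℝ, EuclideanSpace ℝ (Fin n))
      (e.symm.trans e') (e x) :=
    MDifferentiableAt.comp (I' := 𝓡 n) (g := e') (f := e.symm) (e x) (hd'.mdifferentiableAt (by simpa [hx] using hx'))
      (hd.mdifferentiableAt_symm (e.map_source hx))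
  have heq : (e' : M → EuclideanSpace ℝ (Fin n)) =ᶠ[𝓝 x] e.symm.trans e' ∘ e := by
    filter_upwards [e.open_source.mem_nhds hx] with y hy
    simp [e.left_inv hy]
  have h2 : (mfderiv (𝓡 n) 𝓘(ℝ, EuclideanSpace ℝ (Fin n)) e' x v : EuclideanSpace ℝ (Fin n))
      = fderiv ℝ (e.symm.trans e') (e x)
        (mfderiv (𝓡 n) 𝓘(ℝ, EuclideanSpace ℝ (Fin n)) e x v) := by
    rw [heq.mfderiv_eq, mfderiv_comp x hm (hd.mdifferentiableAt hx), mfderiv_eq_fderiv]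
    rfl
  rw [h2]
  exact h1

theorem finrank_tangentSpace (x : M) : Module.finrank ℝ (F.tangentSpace x) = p := by
  obtain ⟨e, he, hx⟩ := F.cover x
  let L := tangentEquiv (F.charts_subset he) hx
  refine (LinearEquiv.finrank_eq (L.toLinearEquiv.ofSubmodules _
    (horizontalSubspace n p) ?_)).trans (finrank_horizontalSubspace F.dim_le)
  ext v
  obtain ⟨w, rfl⟩ := L.surjective v
  constructor
  · rintro ⟨w', hw', h⟩
    rw [← h]
    exact (F.mem_tangentSpace_iff he hx).1 hw'
  · intro h
    exact ⟨w, (F.mem_tangentSpace_iff he hx).2 h, rfl⟩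

-- The point `x` is needed: on an empty manifold complementarity does not constrain `p` and `q`.
variable {F G} in
theorem Complementary.add_eq (h : F.Complementary G) (x : M) : p + q = n := by
  rw [← F.finrank_tangentSpace x, ← G.finrank_tangentSpace x,
    Submodule.finrank_add_eq_of_isCompl (h x)]
  exact finrank_euclideanSpace_fin

end SmoothFoliation

end Charts

/-! ### Existence of transverse metrics. -/

section TransverseMetric

variable {n : ℕ} {M : Type*} [TopologicalSpace M] [ChartedSpace (EuclideanSpace ℝ (Fin n)) M]
  [IsManifold (𝓡 n) ∞ M]

variable (n M) in
/-- A (not necessarily continuous) field of bilinear forms on the tangent spaces. -/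
abbrev BilinField : Type _ :=
  ∀ x : M, TangentSpace (𝓡 n) x →L[ℝ] TangentSpace (𝓡 n) x →L[ℝ] ℝ

namespace BilinField

/-- The field of bilinear forms is smooth at the point `x`. -/
def SmoothAt (B : BilinField n M) (x : M) : Prop :=
  ContMDiffAt (𝓡 n) ((𝓡 n).prod 𝓘(ℝ, EuclideanSpace ℝ (Fin n) →L[ℝ]
      EuclideanSpace ℝ (Fin n) →L[ℝ] ℝ)) ∞
    (fun y => Bundle.TotalSpace.mk' (EuclideanSpace ℝ (Fin n) →L[ℝ]
      EuclideanSpace ℝ (Fin n) →L[ℝ] ℝ)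
      (E := fun y : M => TangentSpace (𝓡 n) y →L[ℝ] TangentSpace (𝓡 n) y →L[ℝ] ℝ) y (B y)) x

/-- Smoothness can be checked in the trivialization of the tangent bundle. -/
theorem smoothAt_of_eventually_eq {B : BilinField n M} {x : M}
    {Φ : M → EuclideanSpace ℝ (Fin n) →L[ℝ] EuclideanSpace ℝ (Fin n) →L[ℝ] ℝ}
    (hΦ : ContMDiffAt (𝓡 n) 𝓘(ℝ, EuclideanSpace ℝ (Fin n) →L[ℝ]
      EuclideanSpace ℝ (Fin n) →L[ℝ] ℝ) ∞ Φ x)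
    (h : ∀ᶠ y in 𝓝 x, ∀ v w : EuclideanSpace ℝ (Fin n),
      B y ((trivializationAt (EuclideanSpace ℝ (Fin n)) (TangentSpace (𝓡 n)) x).symmL ℝ y v)
        ((trivializationAt (EuclideanSpace ℝ (Fin n)) (TangentSpace (𝓡 n)) x).symmL ℝ y w)
        = Φ y v w) : B.SmoothAt x := by
  rw [SmoothAt, contMDiffAt_hom_bundle]
  refine ⟨contMDiffAt_id, hΦ.congr_of_eventuallyEq ?_⟩
  have hb : ∀ᶠ y in 𝓝 x,
      y ∈ (trivializationAt (EuclideanSpace ℝ (Fin n)) (TangentSpace (𝓡 n)) x).baseSet :=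
    (trivializationAt (EuclideanSpace ℝ (Fin n)) (TangentSpace (𝓡 n)) x).open_baseSet.mem_nhds
      (FiberBundle.mem_baseSet_trivializationAt' x)
  filter_upwards [h, hb] with y hy hby
  ext v w
  rw [← hy v w]
  refine (inCoordinates_apply_eq₂ (𝕜 := ℝ) (E₁ := fun y : M => TangentSpace (𝓡 n) y)
    (E₂ := fun y : M => TangentSpace (𝓡 n) y) (E₃ := Bundle.Trivial M ℝ) (F₃ := ℝ)
    (ϕ := B y) hby hby (by simp)).trans ?_
  rw [Bundle.Trivialization.symmL_apply _ hby, Bundle.Trivialization.symmL_apply _ hby]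
  simp

theorem SmoothAt.apply {B : BilinField n M} {x : M} (hB : B.SmoothAt x)
    {X Y : ∀ y : M, TangentSpace (𝓡 n) y} (hX : SmoothFieldAt X x) (hY : SmoothFieldAt Y x) :
    ContMDiffAt (𝓡 n) 𝓘(ℝ, ℝ) ∞ (fun y => B y (X y) (Y y)) x := by
  have := ContMDiffAt.clm_bundle_apply₂ (E₃ := Bundle.Trivial M ℝ) (F₃ := ℝ) (b := fun y : M => y)
    hB hX hY
  simp only [Bundle.contMDiffAt_totalSpace] at this
  exact this.2

end BilinField

/-- In a trivialization of the tangent bundle the derivative of a smooth chart is the derivative of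
the transition map. -/
theorem mfderiv_symmL_trivializationAt {e : OpenPartialHomeomorph M (EuclideanSpace ℝ (Fin n))}
    (he : e ∈ IsManifold.maximalAtlas (𝓡 n) ∞ M) {x y : M} (hy : y ∈ e.source)
    (hyx : y ∈ (chartAt (EuclideanSpace ℝ (Fin n)) x).source) (v : EuclideanSpace ℝ (Fin n)) :
    chartDeriv e y
      ((trivializationAt (EuclideanSpace ℝ (Fin n)) (TangentSpace (𝓡 n)) x).symmL ℝ y v)
      = fderiv ℝ (e ∘ (chartAt (EuclideanSpace ℝ (Fin n)) x).symm)
          (chartAt (EuclideanSpace ℝ (Fin n)) x y) v := by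
  let c := chartAt (EuclideanSpace ℝ (Fin n)) x
  have hc := mdifferentiable_of_mem_maximalAtlas
    (IsManifold.chart_mem_maximalAtlas (I := 𝓡 n) (n := ∞) x)
  have hd := mdifferentiable_of_mem_maximalAtlas he
  have hm : MDifferentiableAt 𝓘(ℝ, EuclideanSpace ℝ (Fin n)) 𝓘(ℝ, EuclideanSpace ℝ (Fin n))
      (e ∘ c.symm) (c y) :=
    MDifferentiableAt.comp (I' := 𝓡 n) (g := e) (f := c.symm) (c y)
      (by rw [c.left_inv hyx]; exact hd.mdifferentiableAt hy)
      (hc.mdifferentiableAt_symm (c.map_source hyx))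
  have heq : (e : M → EuclideanSpace ℝ (Fin n)) =ᶠ[𝓝 y] (e ∘ c.symm) ∘ c := by
    filter_upwards [c.open_source.mem_nhds hyx] with z hz
    simp [c.left_inv hz]
  have h1 : ∀ w : TangentSpace (𝓡 n) y,
      chartDeriv e y w = fderiv ℝ (e ∘ c.symm) (c y) (chartDeriv c y w) := by
    intro w
    rw [chartDeriv, heq.mfderiv_eq, mfderiv_comp y hm (hc.mdifferentiableAt hyx), mfderiv_eq_fderiv]
    rfl
  have h2 : chartDeriv c y
      ((trivializationAt (EuclideanSpace ℝ (Fin n)) (TangentSpace (𝓡 n)) x).symmL ℝ y v) = v := by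
    have h3 := TangentBundle.continuousLinearMapAt_trivializationAt (I := 𝓡 n) hyx
    have h4 := (trivializationAt (EuclideanSpace ℝ (Fin n))
      (TangentSpace (𝓡 n)) x).continuousLinearMapAt_symmL (R := ℝ) (b := y) hyx v
    rw [h3] at h4
    exact h4
  rw [h1, h2]

/-- The transverse part of the Euclidean metric, pulled back by a chart. -/
def chartTransverse (e : OpenPartialHomeomorph M (EuclideanSpace ℝ (Fin n))) (q : ℕ) :
    BilinField n M := fun y =>
  ∑ i ∈ Finset.univ.filter fun i : Fin n => q ≤ (i : ℕ),
    let φ : TangentSpace (𝓡 n) y →L[ℝ] ℝ := (EuclideanSpace.proj i).comp (chartDeriv e y)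
    φ.smulRight φ

omit [IsManifold (𝓡 n) ∞ M] in
theorem chartTransverse_apply (e : OpenPartialHomeomorph M (EuclideanSpace ℝ (Fin n))) (q : ℕ)
    {y : M} (v w : TangentSpace (𝓡 n) y) : chartTransverse e q y v w =
      ∑ i ∈ Finset.univ.filter fun i : Fin n => q ≤ (i : ℕ),
        chartDeriv e y v i * chartDeriv e y w i := by
  simp only [chartTransverse, _root_.sum_apply]
  rfl

/-- In the trivialization at `x` the derivative of `e` becomes the derivative `D` of a transition
map, and the form is quadratic in `D`. -/
theorem smoothAt_chartTransverse {e : OpenPartialHomeomorph M (EuclideanSpace ℝ (Fin n))}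
    (he : e ∈ IsManifold.maximalAtlas (𝓡 n) ∞ M) (q : ℕ) {x : M} (hx : x ∈ e.source) :
    (chartTransverse e q).SmoothAt x := by
  let c := chartAt (EuclideanSpace ℝ (Fin n)) x
  have hxc : x ∈ c.source := mem_chart_source _ x
  let D : M → EuclideanSpace ℝ (Fin n) →L[ℝ] EuclideanSpace ℝ (Fin n) :=
    fun y => fderiv ℝ (e ∘ c.symm) (c y)
  have hD : ContMDiffAt (𝓡 n)
      𝓘(ℝ, EuclideanSpace ℝ (Fin n) →L[ℝ] EuclideanSpace ℝ (Fin n)) ∞ D x := by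
    have h1 : ContMDiffAt (𝓡 n) (𝓡 n) ∞ (e ∘ c.symm) (c x) :=
      ContMDiffAt.comp (I' := 𝓡 n) (g := e) (f := c.symm) (c x)
        (contMDiffAt_of_mem_maximalAtlas he (by rwa [c.left_inv hxc]))
        (contMDiffAt_symm_of_mem_maximalAtlas
          (IsManifold.chart_mem_maximalAtlas x) (c.map_source hxc))
    have h2 : ContDiffAt ℝ ∞ (fderiv ℝ (e ∘ c.symm)) (c x) :=
      h1.contDiffAt.fderiv_right (by simp)
    exact h2.contMDiffAt.comp x (contMDiffAt_of_mem_maximalAtlas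
      (IsManifold.chart_mem_maximalAtlas x) hxc)
  let S (i : Fin n) : (EuclideanSpace ℝ (Fin n) →L[ℝ] EuclideanSpace ℝ (Fin n)) →
      (EuclideanSpace ℝ (Fin n) →L[ℝ] EuclideanSpace ℝ (Fin n) →L[ℝ] ℝ) := fun L =>
    ContinuousLinearMap.smulRightL ℝ _ _ ((EuclideanSpace.proj i).comp L)
      ((EuclideanSpace.proj i).comp L)
  have hS : ∀ i, ContDiff ℝ ∞ (S i) := fun i => by
    have hp : ContDiff ℝ ∞ fun L : EuclideanSpace ℝ (Fin n) →L[ℝ] EuclideanSpace ℝ (Fin n) =>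
      (EuclideanSpace.proj i : EuclideanSpace ℝ (Fin n) →L[ℝ] ℝ).comp L :=
      contDiff_const.clm_comp contDiff_id
    exact ((ContinuousLinearMap.contDiff _).comp hp).clm_apply hp
  refine BilinField.smoothAt_of_eventually_eq
    (Φ := fun y => ∑ i ∈ Finset.univ.filter fun i : Fin n => q ≤ (i : ℕ), S i (D y)) ?_ ?_
  · exact ContMDiffAt.sum fun i _ => (hS i).contMDiff.contMDiffAt.comp x hD
  · filter_upwards [e.open_source.mem_nhds hx, c.open_source.mem_nhds hxc] with y hy hyc v w
    rw [chartTransverse_apply, mfderiv_symmL_trivializationAt he hy hyc,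
      mfderiv_symmL_trivializationAt he hy hyc]
    simp only [_root_.sum_apply]
    rfl

/-- A transverse metric of a foliation: a smooth field of positive semidefinite symmetric bilinear
forms whose kernel is the tangent distribution. -/
structure SmoothFoliation.IsTransverseMetric {q : ℕ} (G : SmoothFoliation n M q)
    (B : BilinField n M) : Prop where
  smoothAt : ∀ x, B.SmoothAt x
  symm : ∀ x v w, B x v w = B x w v
  apply_left : ∀ x, ∀ v ∈ G.tangentSpace x, ∀ w, B x v w = 0
  pos : ∀ x, ∀ v ∉ G.tangentSpace x, 0 < B x v v

-- Being symmetric, vanishing on `TG` and being positive off `TG` are convex conditions at each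
-- point, so a partition of unity glues the local solutions `chartTransverse e q` from foliated
-- charts.
set_option synthInstance.maxHeartbeats 400000 in
set_option maxHeartbeats 1000000 in
theorem SmoothFoliation.exists_isTransverseMetric [T2Space M] [SecondCountableTopology M] {q : ℕ}
    (G : SmoothFoliation n M q) : ∃ B : BilinField n M, G.IsTransverseMetric B := by
  have : LocallyCompactSpace M := ChartedSpace.locallyCompactSpace (EuclideanSpace ℝ (Fin n)) M
  let t (x : M) : Set (TangentSpace (𝓡 n) x →L[ℝ] TangentSpace (𝓡 n) x →L[ℝ] ℝ) :=
    {b | (∀ v w, b v w = b w v) ∧ (∀ v ∈ G.tangentSpace x, ∀ w, b v w = 0) ∧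
      ∀ v ∉ G.tangentSpace x, 0 < b v v}
  have ht : ∀ x, Convex ℝ (t x) := by
    rintro x b ⟨h1, h2, h3⟩ b' ⟨h1', h2', h3'⟩ r s hr hs hrs
    refine ⟨fun v w => ?_, fun v hv w => ?_, fun v hv => ?_⟩
    · simp [h1 v w, h1' v w]
    · simp [h2 v hv w, h2' v hv w]
    · have := h3 v hv
      have := h3' v hv
      simp only [add_apply, smul_apply, smul_eq_mul]
      rcases hr.eq_or_lt with rfl | hr
      · rw [zero_add] at hrs
        simpa [hrs]
      · positivity
  obtain ⟨B, hB⟩ := exists_contMDiffSection_forall_mem_convex_of_local (𝓡 n) (n := ⊤)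
    (F_fiber := EuclideanSpace ℝ (Fin n) →L[ℝ] EuclideanSpace ℝ (Fin n) →L[ℝ] ℝ)
    (V := fun y : M => TangentSpace (𝓡 n) y →L[ℝ] TangentSpace (𝓡 n) y →L[ℝ] ℝ) t ht (by
    intro x
    obtain ⟨e, he, hx⟩ := G.cover x
    refine ⟨e.source, e.open_source.mem_nhds hx, chartTransverse e q, fun y hy =>
      (smoothAt_chartTransverse (G.charts_subset he) q hy).contMDiffWithinAt,
      fun y hy => ⟨fun v w => ?_, fun v hv w => ?_, fun v hv => ?_⟩⟩
    · simp only [chartTransverse_apply, mul_comm]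
    · rw [chartTransverse_apply]
      refine Finset.sum_eq_zero fun i hi => ?_
      rw [(G.mem_tangentSpace_iff he hy).1 hv i (Finset.mem_filter.1 hi).2, zero_mul]
    · rw [chartTransverse_apply]
      rw [G.mem_tangentSpace_iff he hy] at hv
      obtain ⟨i, hi, hne⟩ : ∃ i : Fin n, q ≤ (i : ℕ) ∧
          chartDeriv e y v i ≠ 0 := by
        by_contra! hc
        exact hv hc
      exact Finset.sum_pos' (fun i _ => mul_self_nonneg _)
        ⟨i, by simpa using hi, mul_self_pos.2 hne⟩)
  exact ⟨B, fun x => B.contMDiff x, fun x => (hB x).1, fun x => (hB x).2.1, fun x => (hB x).2.2⟩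

end TransverseMetric

/-! ### Forms and constant fields in a chart. -/

section ChartFields

variable {n : ℕ} {M : Type*} [TopologicalSpace M] [ChartedSpace (EuclideanSpace ℝ (Fin n)) M]
  {e : OpenPartialHomeomorph M (EuclideanSpace ℝ (Fin n))}

/-- The value of a form can be computed in a smooth chart. -/
theorem DiffForm.apply_eq_inChart {k : ℕ} (β : DiffForm n M k)
    (he : e ∈ IsManifold.maximalAtlas (𝓡 n) ∞ M) {x : M} (hx : x ∈ e.source)
    (X : Fin k → TangentSpace (𝓡 n) x) :
    β x X = β.inChart e (e x) (fun i => chartDeriv e x (X i)) := by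
  obtain ⟨u, hu, rfl⟩ : ∃ u ∈ e.target, e.symm u = x := ⟨e x, e.map_source hx, e.left_inv hx⟩
  have hd := mdifferentiable_of_mem_maximalAtlas he
  choose w hw using fun i => hd.symm.mfderiv_surjective hu (X i)
  have h : ∀ i, chartDeriv e (e.symm u) (X i) = w i := fun i => by
    rw [← hw]
    exact DFunLike.congr_fun (hd.comp_symm_deriv hu) (w i)
  simp only [h, e.right_inv hu]
  rw [← funext hw]
  rfl

/-- The vector field that is constant in the chart `e`. -/
def chartField (e : OpenPartialHomeomorph M (EuclideanSpace ℝ (Fin n)))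
    (w : EuclideanSpace ℝ (Fin n)) : ∀ y : M, TangentSpace (𝓡 n) y :=
  VectorField.mpullback (𝓡 n) 𝓘(ℝ, EuclideanSpace ℝ (Fin n)) e (fun _ => w)

theorem isInvertible_chartDeriv (he : e ∈ IsManifold.maximalAtlas (𝓡 n) ∞ M) {x : M}
    (hx : x ∈ e.source) : (chartDeriv e x).IsInvertible :=
  ⟨tangentEquiv he hx, rfl⟩

theorem chartDeriv_chartField (he : e ∈ IsManifold.maximalAtlas (𝓡 n) ∞ M) {x : M}
    (hx : x ∈ e.source) (w : EuclideanSpace ℝ (Fin n)) :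
    chartDeriv e x (chartField e w x) = w :=
  (isInvertible_chartDeriv he hx).self_apply_inverse w

theorem chartField_chartDeriv (he : e ∈ IsManifold.maximalAtlas (𝓡 n) ∞ M) {x : M}
    (hx : x ∈ e.source) (v : TangentSpace (𝓡 n) x) :
    chartField e (chartDeriv e x v) x = v :=
  (isInvertible_chartDeriv he hx).inverse_apply_self v

theorem smoothFieldAt_chartField [IsManifold (𝓡 n) ∞ M]
    (he : e ∈ IsManifold.maximalAtlas (𝓡 n) ∞ M) {x : M}
    (hx : x ∈ e.source) (w : EuclideanSpace ℝ (Fin n)) : SmoothFieldAt (chartField e w) x := by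
  refine ContMDiffAt.mpullback_vectorField_preimage (n := ∞) (m := ∞) ?_
    (contMDiffAt_of_mem_maximalAtlas he hx) (isInvertible_chartDeriv he hx) (by simp)
  exact (contMDiffAt_vectorSpace_iff_contDiffAt
    (V := fun _ : EuclideanSpace ℝ (Fin n) => w)).2 contDiffAt_const

end ChartFields

/-! ### Rescaling a transverse metric to match the defining form. -/

section Normalization

variable {n : ℕ} {M : Type*} [TopologicalSpace M] [ChartedSpace (EuclideanSpace ℝ (Fin n)) M]
  [IsManifold (𝓡 n) ∞ M] {k q : ℕ}

/-- The square of the form `β` is the Gram determinant of `B`. -/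
def BilinField.IsNormalizedBy (B : BilinField n M) (β : DiffForm n M k) : Prop :=
  ∀ x (X : Fin k → TangentSpace (𝓡 n) x), β x X ^ 2 = (Matrix.of fun i j => B x (X i) (X j)).det

namespace SmoothFoliation

variable {G : SmoothFoliation n M q} {β : DiffForm n M k} {B : BilinField n M}

/-- Both sides factor through a complement of `TG`. If `c` were zero, `β x` would vanish and its
kernel would be all of `T_x M`, against positive codimension. Degree 0 is excluded because the
kernel condition then says nothing about the value of `β`, which may be zero. -/
theorem IsTransverseMetric.exists_pos_sq_eq_mul_det (hB : G.IsTransverseMetric B) (hk : k = n - q)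
    (hk0 : k ≠ 0) (hβ : ∀ x, β.kernel x = (G.tangentSpace x : Set (TangentSpace (𝓡 n) x))) (x : M) :
    ∃ c : ℝ, 0 < c ∧ ∀ X : Fin k → TangentSpace (𝓡 n) x,
      β x X ^ 2 = c * (Matrix.of fun i j => B x (X i) (X j)).det := by
  obtain ⟨N', hN'⟩ := (G.tangentSpace x).exists_isCompl
  have hkN : Module.finrank ℝ N' = k := by
    have h := Submodule.finrank_add_eq_of_isCompl hN'
    have h' : Module.finrank ℝ (TangentSpace (𝓡 n) x) = n := finrank_euclideanSpace_fin
    rw [G.finrank_tangentSpace, h'] at h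
    omega
  obtain ⟨c, hc, h⟩ := exists_sq_eq_mul_det hN'.symm hkN (β x).toAlternatingMap
    (fun v hv m hm => by
      have : v ∈ β.kernel x := by rw [hβ]; exact hv
      exact this m hm)
    (LinearMap.mk₂ ℝ (fun v w => B x v w) (by simp) (by simp) (by simp) (by simp))
    (fun v hv w => hB.apply_left x v hv w)
    (fun v hv w => (hB.symm x w v).trans (hB.apply_left x v hv w))
    (fun v hv hv0 => hB.pos x v fun hv' => hv0 <| by
      simpa using (Submodule.disjoint_def.1 hN'.disjoint) v hv' hv)
    (fun v w => hB.symm x v w)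
  have h' : ∀ X : Fin k → TangentSpace (𝓡 n) x,
    β x X ^ 2 = c * (Matrix.of fun i j => B x (X i) (X j)).det := h
  refine ⟨c, hc.lt_of_ne' ?_, h'⟩
  rintro rfl
  have hN0 : N' ≠ ⊥ := by
    rintro rfl
    rw [finrank_bot] at hkN
    exact hk0 hkN.symm
  obtain ⟨v, hv, hv0⟩ := Submodule.exists_mem_ne_zero_of_ne_bot hN0
  refine hv0 (Submodule.disjoint_def.1 hN'.disjoint v ?_ hv)
  rw [← SetLike.mem_coe, ← hβ]
  intro m _
  have := h' m
  rwa [zero_mul, sq_eq_zero_iff] at this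

theorem IsTransverseMetric.smul (hB : G.IsTransverseMetric B) {r : M → ℝ} (hr : ∀ x, 0 < r x)
    (hs : ContMDiff (𝓡 n) 𝓘(ℝ, ℝ) ∞ r) : G.IsTransverseMetric (fun x => r x • B x) where
  smoothAt x := ContMDiffAt.smul_section (hs x) (hB.smoothAt x)
  symm x v w := by
    change r x * B x v w = r x * B x w v
    rw [hB.symm]
  apply_left x v hv w := by
    change r x * B x v w = 0
    rw [hB.apply_left x v hv, mul_zero]
  pos x v hv := mul_pos (hr x) (hB.pos x v hv)

/-- A foliation with a defining form has a transverse metric for which the form is the transverse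
volume form, up to sign. -/
theorem exists_isTransverseMetric_isNormalizedBy [T2Space M] [SecondCountableTopology M]
    (G : SmoothFoliation n M q) (hk : k = n - q) (hs : β.IsSmooth)
    (hβ : ∀ x, β.kernel x = (G.tangentSpace x : Set (TangentSpace (𝓡 n) x))) :
    ∃ B : BilinField n M, G.IsTransverseMetric B ∧ (k ≠ 0 → B.IsNormalizedBy β) := by
  obtain ⟨B, hB⟩ := G.exists_isTransverseMetric
  by_cases hk0 : k = 0
  · exact ⟨B, hB, fun h => absurd hk0 h⟩
  choose c hc h using hB.exists_pos_sq_eq_mul_det hk hk0 hβ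
  have hcs : ContMDiff (𝓡 n) 𝓘(ℝ, ℝ) ∞ c := by
    intro x
    -- Otherwise `T_x G` is the whole tangent space, so `q = n` and `k = 0`.
    obtain ⟨m, hm⟩ : ∃ m, β x m ≠ 0 := by
      by_contra! h0
      have hmem : ∀ v, v ∈ G.tangentSpace x := fun v => by
        rw [← SetLike.mem_coe, ← hβ]
        exact fun m _ => h0 m
      have h1 := G.finrank_tangentSpace x
      rw [Submodule.eq_top_iff'.2 hmem, finrank_top] at h1
      have h' : Module.finrank ℝ (TangentSpace (𝓡 n) x) = n := finrank_euclideanSpace_fin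
      omega
    let e := chartAt (EuclideanSpace ℝ (Fin n)) x
    have he : e ∈ IsManifold.maximalAtlas (𝓡 n) ∞ M := IsManifold.chart_mem_maximalAtlas x
    have hx : x ∈ e.source := mem_chart_source _ x
    -- Evaluating on a smooth local extension of `m` exhibits `c` near `x` as a quotient of smooth
    -- functions with nonzero denominator.
    let X : Fin k → ∀ y : M, TangentSpace (𝓡 n) y := fun i => chartField e (chartDeriv e x (m i))
    have hX : ∀ i, X i x = m i := fun i => chartField_chartDeriv he hx _
    let d : M → ℝ := fun y => (Matrix.of fun i j => B y (X i y) (X j y)).det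
    have hd : ContMDiffAt (𝓡 n) 𝓘(ℝ, ℝ) ∞ d x := by
      simp only [d, Matrix.det_apply']
      refine ContMDiffAt.sum fun σ _ => contMDiffAt_const.mul
        (contMDiffAt_finsetProd fun i _ => ?_)
      exact (hB.smoothAt x).apply (smoothFieldAt_chartField he hx _)
        (smoothFieldAt_chartField he hx _)
    have hb : ContMDiffAt (𝓡 n) 𝓘(ℝ, ℝ) ∞ (fun y => β y (fun i => X i y)) x := by
      have h1 : ContDiffAt ℝ ∞ (fun u => β.inChart e u fun i => chartDeriv e x (m i)) (e x) :=
        (ContinuousAlternatingMap.apply ℝ (EuclideanSpace ℝ (Fin n)) ℝ fun i =>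
          chartDeriv e x (m i)).contDiff.contDiffAt.comp _
          ((hs e he).contDiffAt (e.open_target.mem_nhds (e.map_source hx)))
      refine (h1.contMDiffAt.comp x
        (contMDiffAt_of_mem_maximalAtlas he hx)).congr_of_eventuallyEq ?_
      filter_upwards [e.open_source.mem_nhds hx] with y hy
      rw [β.apply_eq_inChart he hy]
      simp only [X, chartDeriv_chartField he hy]
      rfl
    have hdx : d x ≠ 0 := by
      intro h0
      have h2 := h x (fun i => X i x)
      change _ = c x * d x at h2
      rw [h0, mul_zero, sq_eq_zero_iff] at h2
      exact hm (by rwa [funext hX] at h2)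
    have hcd : ∀ᶠ y in 𝓝 x, c y = β y (fun i => X i y) ^ 2 / d y := by
      filter_upwards [hd.continuousAt.eventually_ne hdx] with y hy
      rw [h y, mul_div_assoc, div_self hy, mul_one]
    refine ContMDiffAt.congr_of_eventuallyEq ?_ hcd
    exact (hb.pow 2).div₀ hd hdx
  -- A factor `r` on `B` multiplies the `k × k` Gram determinant by `r ^ k`, hence the `k`-th root
  -- of `c`.
  refine ⟨_, hB.smul (r := fun x => c x ^ (k : ℝ)⁻¹) (fun x => Real.rpow_pos_of_pos (hc x) _)
    fun x => ?_, fun _ x X => ?_⟩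
  · exact (Real.contDiffAt_rpow_const_of_ne (hc x).ne').contMDiffAt.comp x (hcs x)
  · rw [h x X]
    have : (Matrix.of fun i j => (c x ^ (k : ℝ)⁻¹ • B x) (X i) (X j))
        = c x ^ (k : ℝ)⁻¹ • Matrix.of fun i j => B x (X i) (X j) := by
      ext i j
      rfl
    rw [this, Matrix.det_smul, Fintype.card_fin, Real.rpow_inv_natCast_pow (hc x).le hk0]

end SmoothFoliation

end Normalization

/-! ### Vector fields, derivatives and Lie brackets in a chart. -/

section ChartCalculus

variable {n : ℕ} {M : Type*} [TopologicalSpace M] [ChartedSpace (EuclideanSpace ℝ (Fin n)) M]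
  {e : OpenPartialHomeomorph M (EuclideanSpace ℝ (Fin n))}

/-- The expression of a vector field in a chart. -/
def fieldInChart (e : OpenPartialHomeomorph M (EuclideanSpace ℝ (Fin n)))
    (X : ∀ y : M, TangentSpace (𝓡 n) y) (u : EuclideanSpace ℝ (Fin n)) :
    EuclideanSpace ℝ (Fin n) :=
  VectorField.mpullback 𝓘(ℝ, EuclideanSpace ℝ (Fin n)) (𝓡 n) e.symm X u

theorem isInvertible_mfderiv_symm (he : e ∈ IsManifold.maximalAtlas (𝓡 n) ∞ M)
    {u : EuclideanSpace ℝ (Fin n)} (hu : u ∈ e.target) :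
    (mfderiv 𝓘(ℝ, EuclideanSpace ℝ (Fin n)) (𝓡 n) e.symm u).IsInvertible :=
  ⟨(mdifferentiable_of_mem_maximalAtlas he).symm.mfderiv hu, rfl⟩

theorem chartDeriv_mfderiv_symm (he : e ∈ IsManifold.maximalAtlas (𝓡 n) ∞ M)
    {u : EuclideanSpace ℝ (Fin n)} (hu : u ∈ e.target) (w : EuclideanSpace ℝ (Fin n)) :
    chartDeriv e (e.symm u) (mfderiv 𝓘(ℝ, EuclideanSpace ℝ (Fin n)) (𝓡 n) e.symm u w) = w :=
  DFunLike.congr_fun ((mdifferentiable_of_mem_maximalAtlas he).comp_symm_deriv hu) w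

theorem chartDeriv_eq_fieldInChart (he : e ∈ IsManifold.maximalAtlas (𝓡 n) ∞ M)
    (X : ∀ y : M, TangentSpace (𝓡 n) y) {x : M} (hx : x ∈ e.source) :
    chartDeriv e x (X x) = fieldInChart e X (e x) := by
  obtain ⟨u, hu, rfl⟩ : ∃ u ∈ e.target, e.symm u = x := ⟨e x, e.map_source hx, e.left_inv hx⟩
  rw [e.right_inv hu]
  have h : mfderiv 𝓘(ℝ, EuclideanSpace ℝ (Fin n)) (𝓡 n) e.symm u (fieldInChart e X u)
      = X (e.symm u) := (isInvertible_mfderiv_symm he hu).self_apply_inverse _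
  rw [← h]
  exact chartDeriv_mfderiv_symm he hu _

theorem fieldInChart_chartField (he : e ∈ IsManifold.maximalAtlas (𝓡 n) ∞ M)
    {u : EuclideanSpace ℝ (Fin n)} (hu : u ∈ e.target) (w : EuclideanSpace ℝ (Fin n)) :
    fieldInChart e (chartField e w) u = w := by
  have h := chartDeriv_eq_fieldInChart he (chartField e w) (e.map_target hu)
  rw [chartDeriv_chartField he (e.map_target hu), e.right_inv hu] at h
  exact h.symm

theorem mvfderiv_chartField (he : e ∈ IsManifold.maximalAtlas (𝓡 n) ∞ M) {x : M}
    (hx : x ∈ e.source) {f : M → ℝ} (hf : MDifferentiableAt (𝓡 n) 𝓘(ℝ, ℝ) f x)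
    (w : EuclideanSpace ℝ (Fin n)) :
    DifferentiableAt ℝ (f ∘ e.symm) (e x) ∧
    mvfderiv (𝓡 n) f x (chartField e w x) = fderiv ℝ (f ∘ e.symm) (e x) w := by
  have hd := mdifferentiable_of_mem_maximalAtlas he
  have hm : MDifferentiableAt 𝓘(ℝ, EuclideanSpace ℝ (Fin n)) 𝓘(ℝ, ℝ) (f ∘ e.symm) (e x) :=
    MDifferentiableAt.comp (I' := 𝓡 n) (g := f) (f := e.symm) (e x) (by rwa [e.left_inv hx])
      (hd.mdifferentiableAt_symm (e.map_source hx))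
  refine ⟨hm.differentiableAt, ?_⟩
  have heq : f =ᶠ[𝓝 x] (f ∘ e.symm) ∘ e := by
    filter_upwards [e.open_source.mem_nhds hx] with y hy
    simp [e.left_inv hy]
  have h : mvfderiv (𝓡 n) f x (chartField e w x)
      = fderiv ℝ (f ∘ e.symm) (e x) (chartDeriv e x (chartField e w x)) := by
    rw [mvfderiv, heq.mfderiv_eq, mfderiv_comp x hm (hd.mdifferentiableAt hx), mfderiv_eq_fderiv]
    rfl
  rw [h, chartDeriv_chartField he hx]

theorem differentiableAt_fieldInChart [IsManifold (𝓡 n) ∞ M]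
    (he : e ∈ IsManifold.maximalAtlas (𝓡 n) ∞ M) {x : M} (hx : x ∈ e.source)
    {X : ∀ y : M, TangentSpace (𝓡 n) y} (hX : SmoothFieldAt X x) :
    DifferentiableAt ℝ (fieldInChart e X) (e x) := by
  have hX' : SmoothFieldAt X (e.symm (e x)) := by rwa [e.left_inv hx]
  have h := ContMDiffAt.mpullback_vectorField_preimage (n := ∞) (m := ∞) (f := e.symm)
    (I := 𝓘(ℝ, EuclideanSpace ℝ (Fin n))) (x₀ := e x) hX'
    (contMDiffAt_symm_of_mem_maximalAtlas he (e.map_source hx))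
    (isInvertible_mfderiv_symm he (e.map_source hx)) (by simp)
  exact (contMDiffAt_vectorSpace_iff_contDiffAt.1 h).differentiableAt (by simp)

theorem mlieBracket_eq_lieBracket {E : Type*} [NormedAddCommGroup E] [NormedSpace ℝ E]
    (W V : ∀ u : E, TangentSpace 𝓘(ℝ, E) u) (u : E) :
    VectorField.mlieBracket 𝓘(ℝ, E) W V u = VectorField.lieBracket ℝ W V u := by
  rw [← VectorField.mlieBracketWithin_univ,
    VectorField.mlieBracketWithin_eq_lieBracketWithin]
  exact congrFun VectorField.lieBracketWithin_univ u

theorem lieBracket_const_left {E : Type*} [NormedAddCommGroup E] [NormedSpace ℝ E] (w : E)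
    (V : E → E) (u : E) : VectorField.lieBracket ℝ (fun _ => w) V u = fderiv ℝ V u w := by
  simp [VectorField.lieBracket]

/-- In a chart, the Lie bracket with a constant field is a directional derivative. -/
theorem chartDeriv_mlieBracket_chartField [IsManifold (𝓡 n) ∞ M]
    (he : e ∈ IsManifold.maximalAtlas (𝓡 n) ∞ M) {x : M} (hx : x ∈ e.source)
    {X : ∀ y : M, TangentSpace (𝓡 n) y} (hX : DiffFieldAt X x) (w : EuclideanSpace ℝ (Fin n)) :
    chartDeriv e x (VectorField.mlieBracket (𝓡 n) (chartField e w) X x)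
      = fderiv ℝ (fieldInChart e X) (e x) w := by
  have : IsManifold (𝓡 n) (minSmoothness ℝ 3) M := IsManifold.of_le (n := ∞) (by
    rw [minSmoothness_of_isRCLikeNormedField]
    exact ENat.LEInfty.out)
  have hu := e.map_source hx
  have hs : e.symm (e x) ∈ e.source := e.map_target hu
  have hX' : DiffFieldAt X (e.symm (e x)) := by rwa [e.left_inv hx]
  have hZ' : DiffFieldAt (chartField e w) (e.symm (e x)) :=
    (smoothFieldAt_chartField he hs w).mdifferentiableAt (by simp)
  rw [chartDeriv_eq_fieldInChart he _ hx]
  have h := VectorField.mpullback_mlieBracket (n := ∞) (f := e.symm)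
    (I := 𝓘(ℝ, EuclideanSpace ℝ (Fin n))) (x₀ := e x) hZ' hX'
    (contMDiffAt_symm_of_mem_maximalAtlas he hu) (by
      rw [minSmoothness_of_isRCLikeNormedField]
      exact ENat.LEInfty.out)
  refine h.trans ?_
  have hZ : VectorField.mpullback 𝓘(ℝ, EuclideanSpace ℝ (Fin n)) (𝓡 n) e.symm (chartField e w)
      =ᶠ[𝓝 (e x)] fun _ => w := by
    filter_upwards [e.open_target.mem_nhds hu] with u hu
    exact fieldInChart_chartField he hu w
  refine (hZ.mlieBracket_vectorField_eq Filter.EventuallyEq.rfl).trans ?_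
  exact (mlieBracket_eq_lieBracket _ _ _).trans (lieBracket_const_left w _ _)

end ChartCalculus

/-! ### Closedness of the form and vanishing of the mean curvature. -/

section Minimality

variable {n : ℕ} {M : Type*} [TopologicalSpace M] [ChartedSpace (EuclideanSpace ℝ (Fin n)) M]
  {k p q : ℕ} {e : OpenPartialHomeomorph M (EuclideanSpace ℝ (Fin n))}

/-- A closed form is invariant under the constant fields in its kernel. -/
theorem DiffForm.fderiv_inChart_eq_zero {β : DiffForm n M k} (hs : β.IsSmooth) (hc : β.IsClosed)
    (he : e ∈ IsManifold.maximalAtlas (𝓡 n) ∞ M) {u : EuclideanSpace ℝ (Fin n)}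
    (hu : u ∈ e.target) {w : EuclideanSpace ℝ (Fin n)}
    (hw : ∀ y ∈ e.source, chartField e w y ∈ β.kernel y) : fderiv ℝ (β.inChart e) u w = 0 := by
  have hd : DifferentiableAt ℝ (β.inChart e) u :=
    ((hs e he).contDiffAt (e.open_target.mem_nhds hu)).differentiableAt (by simp)
  have hker : ∀ u ∈ e.target, ∀ m : Fin k → EuclideanSpace ℝ (Fin n), (∃ i, m i = w) →
      β.inChart e u m = 0 := by
    rintro u hu m ⟨i, hi⟩
    have h := β.apply_eq_inChart he (e.map_target hu) fun j => chartField e (m j) (e.symm u)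
    simp only [chartDeriv_chartField he (e.map_target hu), e.right_inv hu] at h
    rw [← h]
    refine hw _ (e.map_target hu) _ ⟨i, ?_⟩
    rw [hi]
  ext m
  -- In `dβ(w, m)` only the term that differentiates along `w` survives: all others keep `w` among
  -- the arguments of `β`, so they differentiate a function vanishing near `u`.
  have h := congrArg (fun f => f (Fin.cons w m : Fin (k + 1) → EuclideanSpace ℝ (Fin n)))
    (hc e he u hu)
  simp only [extDeriv_apply hd, Fin.sum_univ_succ] at h
  rw [Finset.sum_eq_zero] at h
  · have h2 : HasFDerivAt (fun y => β.inChart e y m)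
      ((ContinuousAlternatingMap.apply ℝ (EuclideanSpace ℝ (Fin n)) ℝ m).comp
        (fderiv ℝ (β.inChart e) u)) u :=
      (ContinuousAlternatingMap.apply ℝ (EuclideanSpace ℝ (Fin n)) ℝ m).hasFDerivAt.comp u
        hd.hasFDerivAt
    have h3 : Fin.removeNth 0 (Fin.cons w m : Fin (k + 1) → EuclideanSpace ℝ (Fin n)) = m := by
      ext i
      simp [Fin.removeNth]
    rw [h3, h2.fderiv] at h
    simpa using h
  · intro i _
    have h0 : (fun y => β.inChart e y (i.succ.removeNth
        (Fin.cons w m : Fin (k + 1) → EuclideanSpace ℝ (Fin n)))) =ᶠ[𝓝 u] fun _ => (0 : ℝ) := by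
      filter_upwards [e.open_target.mem_nhds hu] with y hy
      refine hker y hy _ ⟨⟨0, i.pos⟩, ?_⟩
      have : (i.succ.succAbove ⟨0, i.pos⟩) = 0 := by
        rw [Fin.succAbove_of_castSucc_lt _ _ (by simp [Fin.lt_def])]
        rfl
      simp [Fin.removeNth, this]
    rw [h0.fderiv_eq]
    simp

variable [IsManifold (𝓡 n) ∞ M]

namespace RiemannianMetricOn

variable (g : RiemannianMetricOn n M)

/-- The Koszul formula for `g(∇_X X, Z)`, for orthogonal fields `X` and `Z`. -/
theorem inner_leviCivita_self {X Z : ∀ y : M, TangentSpace (𝓡 n) y} {x : M}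
    (hX : DiffFieldAt X x) (hZ : DiffFieldAt Z x) (h : ∀ᶠ y in 𝓝 x, g.inner y (X y) (Z y) = 0) :
    g.inner x (g.leviCivita X X x) (Z x) =
      g.inner x (VectorField.mlieBracket (𝓡 n) Z X x) (X x)
        - 1 / 2 * mvfderiv (𝓡 n) (fun y => g.inner y (X y) (X y)) x (Z x) := by
  have h0 : mvfderiv (𝓡 n) (fun y => g.inner y (X y) (Z y)) x = 0 := by
    have h1 : (fun y => g.inner y (X y) (Z y)) =ᶠ[𝓝 x] fun _ => (0 : ℝ) := h
    have h2 : HasMFDerivAt (𝓡 n) 𝓘(ℝ, ℝ) (fun y => g.inner y (X y) (Z y)) x 0 :=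
      (hasMFDerivAt_const (0 : ℝ) x).congr_of_eventuallyEq h1
    rw [mvfderiv, h2.mfderiv]
    exact ContinuousLinearMap.comp_zero _
  rw [g.inner_leviCivita hX hX hZ, koszul, h0,
    VectorField.mlieBracket_swap (V := X) (W := Z)]
  simp
  ring

end RiemannianMetricOn

namespace SmoothFoliation

variable {F : SmoothFoliation n M p} {G : SmoothFoliation n M q} {B C : BilinField n M}
  {β : DiffForm n M p} {g : RiemannianMetricOn n M}

/-- The normal component of the mean curvature vector vanishes. -/
theorem inner_sum_leviCivita_eq_zero (hB : G.IsTransverseMetric B) (hC : F.IsTransverseMetric C)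
    (hg : ∀ x v w, g.inner x v w = B x v w + C x v w) (hs : β.IsSmooth) (hc : β.IsClosed)
    (hβ : ∀ x, β.kernel x = (G.tangentSpace x : Set (TangentSpace (𝓡 n) x)))
    (hN : B.IsNormalizedBy β) {x : M} {X : Fin p → ∀ y : M, TangentSpace (𝓡 n) y}
    (hX : F.IsTangentFrameAt g x X) {z : TangentSpace (𝓡 n) x} (hz : z ∈ G.tangentSpace x) :
    g.inner x (∑ i, g.leviCivita (X i) (X i) x) z = 0 := by
  obtain ⟨e, he', hx⟩ := G.cover x
  have he := G.charts_subset he'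
  let u₀ := e x
  have hu₀ : u₀ ∈ e.target := e.map_source hx
  let w : EuclideanSpace ℝ (Fin n) := chartDeriv e x z
  -- Since `e` is foliated for `G`, the constant extension of `z` stays tangent to `G`.
  have hw : ∀ y ∈ e.source, chartField e w y ∈ G.tangentSpace y := fun y hy => by
    rw [G.mem_tangentSpace_iff he' hy, chartDeriv_chartField he hy]
    exact (G.mem_tangentSpace_iff he' hx).1 hz
  have hzw : chartField e w x = z := chartField_chartDeriv he hx z
  have hF : ∀ᶠ y in 𝓝 x, ∀ i, X i y ∈ F.tangentSpace y := Filter.eventually_all.2 hX.tangent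
  have hgB : ∀ᶠ y in 𝓝 x, ∀ i, ∀ v, g.inner y v (X i y) = B y v (X i y) := by
    filter_upwards [hF] with y hy i v
    rw [hg, hC.symm, hC.apply_left y _ (hy i), add_zero]
  have hdX : ∀ i, DiffFieldAt (X i) x := fun i => (hX.smooth i).mdifferentiableAt (by simp)
  let V : Fin p → EuclideanSpace ℝ (Fin n) → EuclideanSpace ℝ (Fin n) :=
    fun i => fieldInChart e (X i)
  have hV : ∀ i, HasFDerivAt (V i) (fderiv ℝ (V i) u₀) u₀ := fun i =>
    (differentiableAt_fieldInChart he hx (hX.smooth i)).hasFDerivAt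
  let A : EuclideanSpace ℝ (Fin n) →L[ℝ] TangentSpace (𝓡 n) x := (tangentEquiv he hx).symm
  have hA : ∀ v, A (chartDeriv e x v) = v := (tangentEquiv he hx).symm_apply_apply
  have hA' : ∀ v, chartDeriv e x (A v) = v := (tangentEquiv he hx).apply_symm_apply
  have hVX : ∀ i, A (V i u₀) = X i x := fun i => by
    rw [← hA (X i x), chartDeriv_eq_fieldInChart he (X i) hx]
  have hbr : ∀ i, VectorField.mlieBracket (𝓡 n) (chartField e w) (X i) x
      = A (fderiv ℝ (V i) u₀ w) := fun i => by
    rw [← chartDeriv_mlieBracket_chartField he hx (hdX i) w, hA]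
  -- the Gram matrix of the frame in the metric, near `x`
  let γ (i j : Fin p) : M → ℝ := fun y => g.inner y (X i y) (X j y)
  have hγ := fun i j => mvfderiv_chartField he hx (g.mdifferentiableAt_inner (hdX i) (hdX j)) w
  have hγ1 : (Matrix.of fun i j => (γ i j ∘ e.symm) u₀) = 1 := by
    ext i j
    change γ i j (e.symm (e x)) = _
    rw [e.left_inv hx, Matrix.one_apply]
    exact hX.orthonormal i j
  have hdet := hasFDerivAt_det_of_eq_one
    (A := fun u => Matrix.of fun i j => (γ i j ∘ e.symm) u)
    (fun i j => (hγ i j).1.hasFDerivAt) hγ1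
  -- the Gram matrix of the translates of the frame to `x`
  let b : EuclideanSpace ℝ (Fin n) →L[ℝ] EuclideanSpace ℝ (Fin n) →L[ℝ] ℝ :=
    LinearMap.toContinuousLinearMap (LinearMap.toContinuousLinearMap.toLinearMap ∘ₗ
      LinearMap.mk₂ ℝ (fun v w => B x (A v) (A w)) (by simp) (by simp) (by simp) (by simp))
  have hb : ∀ v w, b v w = B x (A v) (A w) := fun v w => rfl
  have hη : ∀ i j, HasFDerivAt (fun u => b (V i u) (V j u))
      (b.precompR _ (V i u₀) (fderiv ℝ (V j) u₀) + b.precompL _ (fderiv ℝ (V i) u₀) (V j u₀)) u₀ :=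
    fun i j => b.hasFDerivAt_of_bilinear (hV i) (hV j)
  have hη1 : (Matrix.of fun i j => b (V i u₀) (V j u₀)) = 1 := by
    ext i j
    rw [Matrix.of_apply, hb, hVX, hVX, ← hgB.self_of_nhds j, Matrix.one_apply]
    exact hX.orthonormal i j
  have hdet' := hasFDerivAt_det_of_eq_one
    (A := fun u => Matrix.of fun i j => b (V i u) (V j u)) hη hη1
  -- both determinants are squares of values of the form
  have h1 : (fun u => (Matrix.of fun i j => (γ i j ∘ e.symm) u).det)
      =ᶠ[𝓝 u₀] fun u => β.inChart e u (fun i => V i u) ^ 2 := by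
    have hcont : Filter.Tendsto e.symm (𝓝 u₀) (𝓝 x) := by
      have := (e.continuousAt_symm hu₀).tendsto
      rwa [e.left_inv hx] at this
    filter_upwards [e.open_target.mem_nhds hu₀, hcont.eventually hgB] with u hu hgu
    have h := hN (e.symm u) fun i => X i (e.symm u)
    rw [β.apply_eq_inChart he (e.map_target hu)] at h
    simp only [chartDeriv_eq_fieldInChart he _ (e.map_target hu), e.right_inv hu] at h
    rw [h]
    simp only [γ, Function.comp_def, hgu]
  -- The vectors `A (V i u)` need not be tangent to `F` at `x`; the normalization of `B` holds for
  -- all tuples.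
  have h2 : (fun u => (Matrix.of fun i j => b (V i u) (V j u)).det)
      = fun u => β.inChart e u₀ (fun i => V i u) ^ 2 := by
    ext u
    have h := hN x fun i => A (V i u)
    rw [β.apply_eq_inChart he hx] at h
    simp only [hA'] at h
    rw [h]
    rfl
  have hβd : HasFDerivAt (β.inChart e) (fderiv ℝ (β.inChart e) u₀) u₀ :=
    (((hs e he).contDiffAt (e.open_target.mem_nhds hu₀)).differentiableAt (by simp)).hasFDerivAt
  have hβ0 : fderiv ℝ (β.inChart e) u₀ w = 0 :=
    DiffForm.fderiv_inChart_eq_zero hs hc he hu₀ fun y hy => by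
      rw [hβ]
      exact hw y hy
  have h3 := (hβd.continuousAlternatingMap_apply hV).pow 2
  have h4 := ((hasFDerivAt_const (β.inChart e u₀) u₀).continuousAlternatingMap_apply hV).pow 2
  -- The derivatives of the two squares differ only by the term differentiating the coefficients of
  -- `β`, which `hβ0` kills along `w`. Hence the traces of the two Gram derivatives agree along `w`.
  have h5 := hdet.unique (h3.congr_of_eventuallyEq h1)
  rw [h2] at hdet'
  have h6 := hdet'.unique h4
  have h7 : (∑ i, fderiv ℝ (γ i i ∘ e.symm) u₀) w
      = (∑ i, (b.precompR _ (V i u₀) (fderiv ℝ (V i) u₀)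
        + b.precompL _ (fderiv ℝ (V i) u₀) (V i u₀))) w := by
    rw [h5, h6]
    simp [hβ0]
  have h8 : ∀ i, (b.precompR _ (V i u₀) (fderiv ℝ (V i) u₀)
        + b.precompL _ (fderiv ℝ (V i) u₀) (V i u₀)) w
      = 2 * g.inner x (VectorField.mlieBracket (𝓡 n) (chartField e w) (X i) x) (X i x) := by
    intro i
    rw [hbr, hgB.self_of_nhds i]
    change b (V i u₀) (fderiv ℝ (V i) u₀ w) + b (fderiv ℝ (V i) u₀ w) (V i u₀) = _
    rw [hb, hb, hVX, hB.symm, two_mul]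
  have h9 : ∀ i, g.inner x (g.leviCivita (X i) (X i) x) z
      = g.inner x (VectorField.mlieBracket (𝓡 n) (chartField e w) (X i) x) (X i x)
        - 1 / 2 * fderiv ℝ (γ i i ∘ e.symm) u₀ w := by
    intro i
    have h := g.inner_leviCivita_self (hdX i)
      ((smoothFieldAt_chartField he hx w).mdifferentiableAt (by simp)) (by
        filter_upwards [hF, e.open_source.mem_nhds hx] with y hy hye
        rw [hg, hC.apply_left y _ (hy i), hB.symm, hB.apply_left y _ (hw y hye), add_zero])
    rw [hzw] at h
    rw [h, ← (hγ i i).2, hzw]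
  rw [map_sum, sum_apply, Finset.sum_congr rfl fun i _ => h9 i, Finset.sum_sub_distrib,
    ← Finset.mul_sum]
  rw [sum_apply, sum_apply, Finset.sum_congr rfl fun i _ => h8 i, ← Finset.mul_sum] at h7
  rw [h7]
  ring

end SmoothFoliation

end Minimality

/-! ### The metric `B + C` and Rummler's criterion. -/

section Construction

/-- The unit ball of a positive definite bilinear form on a finite-dimensional space is bounded. -/
theorem isVonNBounded_of_pos {E : Type*} [NormedAddCommGroup E] [NormedSpace ℝ E]
    [FiniteDimensional ℝ E] (b : E →L[ℝ] E →L[ℝ] ℝ) (hb : ∀ v, v ≠ 0 → 0 < b v v) :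
    Bornology.IsVonNBounded ℝ {v : E | b v v < 1} := by
  rw [NormedSpace.isVonNBounded_iff]
  have : ProperSpace E := FiniteDimensional.proper ℝ E
  have hcont : Continuous fun v => b v v := b.continuous.clm_apply continuous_id
  rcases (Metric.sphere (0 : E) 1).eq_empty_or_nonempty with h0 | h0
  · have : Subsingleton E := by
      by_contra hn
      rw [not_subsingleton_iff_nontrivial] at hn
      exact (NormedSpace.sphere_nonempty (E := E) (x := 0) (r := 1)).2 zero_le_one |>.ne_empty h0
    exact (Set.toFinite _).isBounded
  obtain ⟨v₀, hv₀, hmin⟩ := (isCompact_sphere (0 : E) 1).exists_isMinOn h0 hcont.continuousOn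
  have hc : 0 < b v₀ v₀ := hb v₀ fun h => by simp [h] at hv₀
  -- By homogeneity `‖v‖ ^ 2 ≤ (b v₀ v₀)⁻¹`; the added 1 avoids a square root, as `‖v‖ ≤ ‖v‖ ^ 2 +
  -- 1`.
  refine (Metric.isBounded_closedBall (x := (0 : E)) (r := (b v₀ v₀)⁻¹ + 1)).subset fun v hv => ?_
  rw [mem_closedBall_zero_iff]
  rcases eq_or_ne v 0 with rfl | hv0
  · rw [norm_zero]
    positivity
  have hn : 0 < ‖v‖ := norm_pos_iff.2 hv0
  have h1 : b v₀ v₀ ≤ b (‖v‖⁻¹ • v) (‖v‖⁻¹ • v) := hmin (by simp [norm_smul, hn.ne'])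
  simp only [map_smul, smul_apply, smul_eq_mul] at h1
  have h2 : b v₀ v₀ * ‖v‖ ^ 2 ≤ b v v := by
    calc b v₀ v₀ * ‖v‖ ^ 2 ≤ ‖v‖⁻¹ * (‖v‖⁻¹ * b v v) * ‖v‖ ^ 2 := by gcongr
      _ = b v v := by field_simp
  have h3 : ‖v‖ ^ 2 ≤ (b v₀ v₀)⁻¹ := by
    rw [← one_div, le_div_iff₀ hc]
    linarith [show b v v < 1 from hv]
  nlinarith [sq_nonneg (‖v‖ - 1 / 2)]

variable {n p q : ℕ} {M : Type*} [TopologicalSpace M]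
  [ChartedSpace (EuclideanSpace ℝ (Fin n)) M] [IsManifold (𝓡 n) ∞ M]

namespace SmoothFoliation

variable {F : SmoothFoliation n M p} {G : SmoothFoliation n M q} {B C : BilinField n M}

/-- The sum of transverse metrics of complementary foliations is a Riemannian metric. -/
def Complementary.metric (h : F.Complementary G) (hB : G.IsTransverseMetric B)
    (hC : F.IsTransverseMetric C) : RiemannianMetricOn n M where
  inner x := B x + C x
  symm x v w := by
    change B x v w + C x v w = B x w v + C x w v
    rw [hB.symm, hC.symm]
  pos x := pos_add_apply h hB hC x
  isVonNBounded x := isVonNBounded_of_pos (E := EuclideanSpace ℝ (Fin n)) (B x + C x)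
    (pos_add_apply h hB hC x)
  contMDiff x := ContMDiffAt.add_section (hB.smoothAt x) (hC.smoothAt x)
where
  pos_add_apply (h : F.Complementary G) (hB : G.IsTransverseMetric B)
      (hC : F.IsTransverseMetric C) (x : M) (v : TangentSpace (𝓡 n) x) (hv : v ≠ 0) :
      0 < (B x + C x) v v := by
    change 0 < B x v v + C x v v
    by_cases hvG : v ∈ G.tangentSpace x
    · have hvF : v ∉ F.tangentSpace x := fun hvF =>
        hv (Submodule.disjoint_def.1 (h x).disjoint v hvF hvG)
      rw [hB.apply_left x v hvG, zero_add]
      exact hC.pos x v hvF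
    · by_cases hvF : v ∈ F.tangentSpace x
      · rw [hC.apply_left x v hvF, add_zero]
        exact hB.pos x v hvG
      · exact add_pos (hB.pos x v hvG) (hC.pos x v hvF)

omit [IsManifold (𝓡 n) ∞ M] in
theorem Complementary.symm (h : F.Complementary G) : G.Complementary F := fun x => (h x).symm

theorem orthogonal_of_isTransverseMetric (hB : G.IsTransverseMetric B) (hC : F.IsTransverseMetric C)
    {g : RiemannianMetricOn n M} (hg : ∀ x v w, g.inner x v w = B x v w + C x v w) :
    F.Orthogonal G g := fun x v hv w hw => by
  rw [hg, hC.apply_left x v hv, hB.symm, hB.apply_left x w hw, add_zero]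

/-- Rummler's criterion. -/
theorem hasMinimalLeaves_of_isNormalizedBy (h : F.Complementary G) (hB : G.IsTransverseMetric B)
    (hC : F.IsTransverseMetric C) {g : RiemannianMetricOn n M}
    (hg : ∀ x v w, g.inner x v w = B x v w + C x v w) {k : ℕ} (hk : k = p) {β : DiffForm n M k}
    (hs : β.IsSmooth) (hc : β.IsClosed)
    (hβ : ∀ x, β.kernel x = (G.tangentSpace x : Set (TangentSpace (𝓡 n) x)))
    (hN : k ≠ 0 → B.IsNormalizedBy β) : F.HasMinimalLeaves g := by
  subst hk
  refine fun _ x _ => ⟨fun v _ => by simp, fun X hX => ?_⟩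
  rw [sub_zero]
  rcases eq_or_ne k 0 with rfl | hk
  · simp
  -- The `G`-component `w` of the sum is orthogonal both to the sum and to `v`, hence to itself.
  obtain ⟨v, hv, w, hw, hvw⟩ := Submodule.mem_sup.1
    ((h x).sup_eq_top ▸ Submodule.mem_top (x := ∑ i, g.leviCivita (X i) (X i) x))
  have h0 := inner_sum_leviCivita_eq_zero hB hC hg hs hc hβ (hN hk) hX hw
  rw [← hvw, map_add, add_apply, orthogonal_of_isTransverseMetric hB hC hg x v hv w hw,
    zero_add] at h0
  have hw0 : w = 0 := by
    by_contra hne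
    exact (g.pos x w hne).ne' h0
  rw [← hvw, hw0, add_zero]
  exact hv

end SmoothFoliation

end Construction

end

theorem mainTheorem8 {n p q : ℕ} (M : Type*) [TopologicalSpace M] [T2Space M]
    [SecondCountableTopology M] [ChartedSpace (EuclideanSpace ℝ (Fin n)) M]
    [IsManifold (𝓡 n) ∞ M]
    (F : SmoothFoliation n M p) (G : SmoothFoliation n M q)
    (hFG : F.Complementary G)
    (hF : F.HasClosedDefiningForm) (hG : G.HasClosedDefiningForm) :
    ∃ g : RiemannianMetricOn n M,
      F.Orthogonal G g ∧ F.HasMinimalLeaves g ∧ G.HasMinimalLeaves g := by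
  obtain ⟨α, hαs, hαc, hα⟩ := hF
  obtain ⟨β, hβs, hβc, hβ⟩ := hG
  -- The roles cross: the form defining `G` controls the leaves of `F`, and conversely.
  obtain ⟨B, hB, hBN⟩ := G.exists_isTransverseMetric_isNormalizedBy rfl hβs hβ
  obtain ⟨C, hC, hCN⟩ := F.exists_isTransverseMetric_isNormalizedBy rfl hαs hα
  have hg : ∀ x v w, (hFG.metric hB hC).inner x v w = B x v w + C x v w := fun x v w => rfl
  refine ⟨hFG.metric hB hC, SmoothFoliation.orthogonal_of_isTransverseMetric hB hC hg,
    fun x₀ x hx => ?_, fun x₀ x hx => ?_⟩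
  -- The degree `n - q` of `β` equals `p` only through `p + q = n`, which is available once a point
  -- is given.
  · have := hFG.add_eq x
    exact SmoothFoliation.hasMinimalLeaves_of_isNormalizedBy hFG hB hC hg (by omega) hβs hβc hβ
      hBN x₀ x hx
  · have := hFG.add_eq x
    exact SmoothFoliation.hasMinimalLeaves_of_isNormalizedBy hFG.symm hC hB
      (fun x v w => (hg x v w).trans (add_comm _ _)) (by omega) hαs hαc hα hCN x₀ x hx
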